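/- Let $k$ be a field, $R=k[x_1,\dots,x_n]$ with its standard grading, and let $I\subset R$ be a homogeneous ideal of codimension (height) $c$, in particular a proper ideal, such that the ring $R/I$ is Cohen–Macaulay. Let \[ \cdots\to F_2\to F_1\to F_0\to R/I\to 0,\qquad F_i=\bigoplus_{j\in\mathbb Z}R(-j)^{\beta_{ij}}, \] be a minimal graded free resolution of $R/I$ with graded Betti numbers $\beta_{ij}$. Then $F_i\neq 0$ if and only if $0\le i\le c$, and the maximal shifts $M_i=\max\{j:\beta_{ij}\neq 0\}$ $(0\le i\le c)$ satisfy \[ M_i\ \ge\ M_{i-1}+1\qquad\text{for all } 1\le i\le c. \] -/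

import Mathlib

attribute [local instance] MvPolynomial.gradedAlgebra

/-- The depth of a local ring `A`: the supremum of the lengths of the `A`-regular sequences of
elements of the maximal ideal. -/
noncomputable def localDepth (A : Type*) [CommRing A] [IsLocalRing A] : ℕ∞ :=
  ⨆ (rs : List A) (_ : ∀ r ∈ rs, r ∈ IsLocalRing.maximalIdeal A)
    (_ : RingTheory.Sequence.IsRegular A rs), (rs.length : ℕ∞)

/-- A local ring is Cohen–Macaulay if it is Noetherian and its depth equals its Krull dimension. -/
def IsCohenMacaulayLocalRing (A : Type*) [CommRing A] [IsLocalRing A] : Prop :=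
  IsNoetherianRing A ∧ (localDepth A : WithBot ℕ∞) = ringKrullDim A

/-- A ring is Cohen–Macaulay if it is Noetherian and all its localizations at maximal ideals are
Cohen–Macaulay local rings. -/
def IsCohenMacaulayRing (A : Type*) [CommRing A] : Prop :=
  IsNoetherianRing A ∧
    ∀ (p : Ideal A) [p.IsMaximal], IsCohenMacaulayLocalRing (Localization.AtPrime p)

/-- `p` is homogeneous of the integer degree `e`: every monomial occurring in `p` has total degree
`e`. For negative `e` this means `p = 0`. -/
def IsHomogeneousOfDegree {k : Type*} [Field k] {n : ℕ} (p : MvPolynomial (Fin n) k) (e : ℤ) :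
    Prop :=
  ∀ m ∈ p.support, (m.degree : ℤ) = e

/-- A minimal graded free resolution `⋯ → F₂ → F₁ → F₀ → R/I → 0` of `R/I`, where
`R = k[x₁, …, xₙ]`. Here `Fᵢ = ⨁ₐ R(-shift i a)` is the free module of rank `rank i` whose
`a`-th basis vector has degree `shift i a`. -/
structure MinimalGradedFreeResolution {k : Type*} [Field k] {n : ℕ}
    (I : Ideal (MvPolynomial (Fin n) k)) where
  /-- the rank of `Fᵢ` -/
  rank : ℕ → ℕ
  /-- the degrees of the basis vectors of `Fᵢ` -/
  shift : ∀ i, Fin (rank i) → ℤ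
  /-- the differential `Fᵢ₊₁ → Fᵢ` -/
  d : ∀ i, (Fin (rank (i + 1)) → MvPolynomial (Fin n) k) →ₗ[MvPolynomial (Fin n) k]
    (Fin (rank i) → MvPolynomial (Fin n) k)
  /-- the augmentation `F₀ → R/I` -/
  aug : (Fin (rank 0) → MvPolynomial (Fin n) k) →ₗ[MvPolynomial (Fin n) k]
    (MvPolynomial (Fin n) k ⧸ I)
  /-- the differentials preserve degrees -/
  d_homogeneous : ∀ (i : ℕ) (b : Fin (rank (i + 1))) (a : Fin (rank i)),
    IsHomogeneousOfDegree (d i (Pi.single b 1) a) (shift (i + 1) b - shift i a)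
  /-- the augmentation preserves degrees -/
  aug_homogeneous : ∀ a : Fin (rank 0), ∃ p : MvPolynomial (Fin n) k,
    IsHomogeneousOfDegree p (shift 0 a) ∧ Ideal.Quotient.mk I p = aug (Pi.single a 1)
  aug_surjective : Function.Surjective aug
  exact_zero : Function.Exact (d 0) aug
  exact_succ : ∀ i, Function.Exact (d (i + 1)) (d i)
  /-- minimality: the image of `Fᵢ₊₁` lies in `(x₁, …, xₙ) Fᵢ` -/
  minimal : ∀ i, LinearMap.range (d i) ≤
    Ideal.span (Set.range (MvPolynomial.X : Fin n → MvPolynomial (Fin n) k)) •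
      (⊤ : Submodule (MvPolynomial (Fin n) k) (Fin (rank i) → MvPolynomial (Fin n) k))

/-- The graded Betti number `βᵢⱼ`: the number of summands `R(-j)` of `Fᵢ`. -/
def MinimalGradedFreeResolution.betti {k : Type*} [Field k] {n : ℕ}
    {I : Ideal (MvPolynomial (Fin n) k)} (F : MinimalGradedFreeResolution I) (i : ℕ) (j : ℤ) : ℕ :=
  Fintype.card {a : Fin (F.rank i) // F.shift i a = j}

/-! Write `m` for the ideal of the variables, `A` for the localization of the polynomial ring at
`m`, and `B` for that of `R/I` at the image of `m`. Everything rests on one claim: for `i < c` no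
row of the matrix of `F.d i` is zero. Given this, take a basis vector of `Fᵢ` of top degree `Mᵢ`.
Some entry in its row is nonzero, and by minimality that entry is homogeneous of positive degree, so
`Fᵢ₊₁` has a basis vector of degree at least `Mᵢ + 1`.

The claim is checked over `A`, where the resolution stays exact and minimal. If row `a` vanished,
the `a`-th coordinate functional would be a cocycle of the dual complex. Since `Ext B A i = 0`, it
would be a coboundary (zero if `i = 0`), hence take values in the maximal ideal, yet it takes the
value 1.

Cohen–Macaulayness gives a `B`-regular sequence `fs` with `B / fs B` of finite length. Reduction to
finite length then yields `Ext B A i = 0` for `i < n - |fs|` and projective dimension at most `n -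
|fs|`, so `Fᵢ = 0` beyond that bound. Comparing heights and dimensions gives `n - |fs| = c`. -/

/-! ### Vanishing of Ext by reduction to finite length -/

section LocalAlgebra

open CategoryTheory Abelian IsLocalRing RingTheory.Sequence

universe u

variable {A : Type u} [CommRing A] [IsLocalRing A] [IsNoetherianRing A]

/-- Over a local ring whose maximal ideal is generated by a regular sequence of length `n`, modules
of finite length have projective dimension at most `n`. -/
theorem hasProjectiveDimensionLT_of_isFiniteLength {xs : List A} (hxs : IsRegular A xs)
    (hm : Ideal.ofList xs = maximalIdeal A) {M : Type u} [AddCommGroup M] [Module A M]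
    (hM : IsFiniteLength A M) :
    HasProjectiveDimensionLT (ModuleCat.of A M) (xs.length + 1) := by
  induction hM with
  | @of_subsingleton M _ _ _ =>
    have := (ModuleCat.isZero_of_subsingleton (ModuleCat.of A M)).hasProjectiveDimensionLT_zero
    exact hasProjectiveDimensionLT_of_ge _ 0 _ (Nat.zero_le _)
  | @of_simple_quotient M _ _ N hs _ ih =>
    have hS : (ShortComplex.mk (ModuleCat.ofHom N.subtype) (ModuleCat.ofHom N.mkQ)
        (by ext x; simp)).ShortExact :=
      { exact := by
          rw [ShortComplex.ShortExact.moduleCat_exact_iff_function_exact]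
          exact LinearMap.exact_subtype_mkQ N
        mono_f := by
          rw [ModuleCat.mono_iff_injective]; exact N.injective_subtype
        epi_g := by
          rw [ModuleCat.epi_iff_surjective]; exact N.mkQ_surjective }
    refine hS.hasProjectiveDimensionLT_X₂ _ ih ?_
    -- The simple quotient is the residue field `A ⧸ (xs)`, whose projective dimension is the length
    -- of `xs`.
    obtain ⟨I, hI, ⟨e⟩⟩ := isSimpleModule_iff_quot_maximal.mp hs
    obtain rfl := IsLocalRing.eq_maximalIdeal hI
    have h1 := ModuleCat.projectiveDimension_quotient_eq_length.{u} xs hxs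
    rw [hm] at h1
    have h2 : HasProjectiveDimensionLE
        (ModuleCat.of A (Shrink.{u} (A ⧸ maximalIdeal A))) xs.length :=
      (projectiveDimension_le_iff _ _).mp h1.le
    exact hasProjectiveDimensionLT_of_iso
      ((Shrink.linearEquiv A _).trans e.symm).toModuleIso _

theorem support_subset_zeroLocus_maximalIdeal {A : Type u} [CommRing A] [IsLocalRing A]
    {M : Type u} [AddCommGroup M] [Module A M] (hM : IsFiniteLength A M) :
    Module.support A M ⊆ PrimeSpectrum.zeroLocus (maximalIdeal A) := by
  induction hM with
  | @of_subsingleton M _ _ _ => simp [Module.support_eq_empty]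
  | @of_simple_quotient M _ _ N hs _ ih =>
    obtain ⟨I, hI, ⟨e⟩⟩ := isSimpleModule_iff_quot_maximal.mp hs
    obtain rfl := IsLocalRing.eq_maximalIdeal hI
    rw [Module.support_of_exact (LinearMap.exact_subtype_mkQ N) N.injective_subtype
      N.mkQ_surjective, e.support_eq, Module.support_eq_zeroLocus (M := A ⧸ _),
      Ideal.annihilator_quotient]
    exact Set.union_subset ih le_rfl

/-- Nakayama's lemma for the multiplication by `x` on an `Ext` module. -/
theorem subsingleton_ext_of_subsingleton_ext_quotSMulTop {M N : ModuleCat.{u} A}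
    [Module.Finite A M] [Module.Finite A N] {x : A} (hx : x ∈ maximalIdeal A)
    (reg : IsSMulRegular M x) (i : ℕ)
    (h : Subsingleton (Ext (ModuleCat.of A (QuotSMulTop x M)) N (i + 1))) :
    Subsingleton (Ext M N i) := by
  -- The cokernel of multiplication by `x` embeds in `Ext (M / xM) N (i + 1) = 0`.
  have surj : ∀ y : Ext M N i, ∃ z : Ext M N i, x • z = y := by
    intro y
    obtain ⟨z, hz⟩ := Ext.contravariant_sequence_exact₁ reg.smulShortComplex_shortExact N y
      (add_comm 1 i) (Subsingleton.elim (α := Ext (ModuleCat.of A (QuotSMulTop x M)) N (i + 1)) _ _)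
    refine ⟨z, ?_⟩
    have h1 (w : Ext M N i) : (Ext.mk₀ (x • 𝟙 M)).comp w (zero_add i) = x • w := by
      rw [Ext.mk₀_smul, Ext.smul_comp, Ext.mk₀_id_comp]
    exact (h1 z).symm.trans hz
  by_contra! ntr
  have : x ∈ (Module.annihilator A (Ext M N i)).jacobson :=
    (IsLocalRing.maximalIdeal_le_jacobson _) hx
  refine Submodule.top_ne_pointwise_smul_of_mem_jacobson_annihilator this ?_
  rw [eq_comm, eq_top_iff]
  intro y _
  obtain ⟨z, rfl⟩ := surj y
  exact Submodule.smul_mem_pointwise_smul _ _ ⊤ trivial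

/-- Let the maximal ideal of `A` be generated by a regular sequence of length `n`. If `fs` is a
weakly regular sequence on `M` such that `M / fs M` has finite length, then `Ext M A i` vanishes
for `i < n - fs.length`. -/
theorem subsingleton_ext_self_of_isWeaklyRegular {xs : List A} (hxs : IsRegular A xs)
    (hm : Ideal.ofList xs = maximalIdeal A) (fs : List A) (hfs : ∀ f ∈ fs, f ∈ maximalIdeal A)
    (M : Type u) [AddCommGroup M] [Module A M] [Module.Finite A M] (reg : IsWeaklyRegular M fs)
    (hM : IsFiniteLength A (M ⧸ (Ideal.ofList fs • ⊤ : Submodule A M)))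
    (i : ℕ) (hi : i + fs.length < xs.length) :
    Subsingleton (Ext (ModuleCat.of A M) (ModuleCat.of A A) i) := by
  induction fs generalizing M i with
  | nil =>
    have hM' : IsFiniteLength A M := (Submodule.quotEquivOfEqBot _
      (by rw [Ideal.ofList_nil, Submodule.bot_smul])).isFiniteLength hM
    -- `M` is supported at the closed point and `xs` is `A`-regular, so Rees' criterion applies.
    refine ModuleCat.subsingleton_ext_of_exists_isRegular (maximalIdeal A) (ModuleCat.of A M) ?_
      (ModuleCat.of A A) ?_ xs ?_ hxs i (by simpa using hi)
    · exact support_subset_zeroLocus_maximalIdeal hM'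
    · rw [lt_top_iff_ne_top]
      exact (Submodule.top_ne_ideal_smul_of_le_jacobson_annihilator
        (IsLocalRing.maximalIdeal_le_jacobson _)).symm
    · intro r hr
      rw [← hm]
      exact Ideal.subset_span hr
  | cons f fs ih =>
    rw [isWeaklyRegular_cons_iff] at reg
    refine subsingleton_ext_of_subsingleton_ext_quotSMulTop (M := ModuleCat.of A M)
      (hfs f (by simp)) reg.1 i (ih (fun g hg ↦ hfs g (by simp [hg])) _ reg.2 ?_ _ ?_)
    · exact (Submodule.quotOfListConsSMulTopEquivQuotSMulTopInner M f fs).isFiniteLength hM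
    · simp only [List.length_cons] at hi; omega

/-- Let the maximal ideal of `A` be generated by a regular sequence of length `n`. If `fs` is a
weakly regular sequence on `M` such that `M / fs M` has finite length, then the projective
dimension of `M` is at most `n - fs.length`. -/
theorem subsingleton_ext_of_isWeaklyRegular {xs : List A} (hxs : IsRegular A xs)
    (hm : Ideal.ofList xs = maximalIdeal A) (fs : List A) (hfs : ∀ f ∈ fs, f ∈ maximalIdeal A)
    (M : Type u) [AddCommGroup M] [Module A M] [Module.Finite A M] [Nontrivial M]
    (reg : IsWeaklyRegular M fs)
    (hM : IsFiniteLength A (M ⧸ (Ideal.ofList fs • ⊤ : Submodule A M)))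
    (N : ModuleCat.{u} A) (i : ℕ) (hi : xs.length < i + fs.length) :
    Subsingleton (Ext (ModuleCat.of A M) N i) := by
  -- The finite length quotient has dimension at most `n`, and dividing by `fs` raises projective
  -- dimension by exactly `|fs|`.
  have h1 := projectiveDimension_lt_iff.mpr (hasProjectiveDimensionLT_of_isFiniteLength hxs hm hM)
  have h2 := ModuleCat.projectiveDimension_quotient_eq_add_length_of_isWeaklyRegular
    (ModuleCat.of A M) fs reg hfs
  have h3 : projectiveDimension (ModuleCat.of A M) < i := by
    by_contra! h
    have h4 : ((i : WithBot ℕ∞) + fs.length) < (xs.length + 1 : ℕ) :=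
      (add_le_add_left h _).trans_lt (h2 ▸ h1)
    norm_cast at h4
    omega
  have := projectiveDimension_lt_iff.mp h3
  exact HasProjectiveDimensionLT.subsingleton _ i i le_rfl N

end LocalAlgebra

/-! ### Ext and the dual of a resolution -/

section Resolution

open CategoryTheory Abelian

universe u

variable {A : Type u} [CommRing A]

/-- If `Ext B N (i + 1) = 0` and `F` is a projective resolution of `B`, then the complex
`Hom(F, N)` is exact at `Hom(Fᵢ₊₁, N)`. -/
theorem exists_comp_eq_of_subsingleton_ext (i : ℕ) (F : ℕ → Type u) [∀ i, AddCommGroup (F i)]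
    [∀ i, Module A (F i)] [∀ i, Module.Projective A (F i)] (d : ∀ i, F (i + 1) →ₗ[A] F i)
    {B : Type u} [AddCommGroup B] [Module A B] (aug : F 0 →ₗ[A] B)
    (haug : Function.Surjective aug) (exact_zero : Function.Exact (d 0) aug)
    (exact_succ : ∀ i, Function.Exact (d (i + 1)) (d i))
    {N : Type u} [AddCommGroup N] [Module A N]
    (h : Subsingleton (Ext (ModuleCat.of A B) (ModuleCat.of A N) (i + 1)))
    (φ : F (i + 1) →ₗ[A] N) (hφ : φ ∘ₗ d (i + 1) = 0) : ∃ ψ : F i →ₗ[A] N, ψ ∘ₗ d i = φ := by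
  induction i generalizing F B with
  | zero =>
    have hS := LinearMap.shortExact_shortComplexKer haug
    have hker : ∀ x, d 0 x ∈ LinearMap.ker aug := fun x ↦ exact_zero.apply_apply_eq_zero x
    let aug' : F 1 →ₗ[A] LinearMap.ker aug := (d 0).codRestrict _ hker
    have haug' : Function.Surjective aug' := by
      rintro ⟨x, hx⟩
      obtain ⟨y, rfl⟩ := (exact_zero x).mp hx
      exact ⟨y, rfl⟩
    have hexact' : Function.Exact (d 1) aug' := by
      intro x
      rw [← exact_succ 0 x]
      exact ⟨fun h ↦ congrArg Subtype.val h, fun h ↦ Subtype.ext h⟩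
    -- The cocycle `φ` descends to the first syzygy `ker aug`; the obstruction to extending it to `F
    -- 0` lies in `Ext B N 1`.
    have hle : LinearMap.ker aug' ≤ LinearMap.ker φ := by
      intro x hx
      obtain ⟨y, rfl⟩ := (hexact' x).mp hx
      exact LinearMap.congr_fun hφ y
    let φ' : LinearMap.ker aug →ₗ[A] N :=
      ((LinearMap.ker aug').liftQ φ hle) ∘ₗ
        (aug'.quotKerEquivOfSurjective haug').symm.toLinearMap
    have hφ' : ∀ x, φ' (aug' x) = φ x := by
      intro x
      have : (aug'.quotKerEquivOfSurjective haug').symm (aug' x) = Submodule.Quotient.mk x := by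
        rw [LinearEquiv.symm_apply_eq]; rfl
      simp [φ', this]
    obtain ⟨ψ, hψ⟩ := Ext.contravariant_sequence_exact₁ hS (ModuleCat.of A N)
      (Ext.mk₀ (ModuleCat.ofHom φ')) (add_comm 1 0)
      (Subsingleton.elim (α := Ext (ModuleCat.of A B) (ModuleCat.of A N) (0 + 1)) _ _)
    obtain ⟨ψ', rfl⟩ := (Ext.mk₀_bijective _ _).2 ψ
    rw [Ext.mk₀_comp_mk₀, (Ext.mk₀_bijective _ _).1.eq_iff] at hψ
    refine ⟨ψ'.hom, LinearMap.ext fun x ↦ ?_⟩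
    rw [← hφ' x]
    exact LinearMap.congr_fun (congrArg ModuleCat.Hom.hom hψ) (aug' x)
  | succ i ih =>
    have hS := LinearMap.shortExact_shortComplexKer haug
    have hker : ∀ x, d 0 x ∈ LinearMap.ker aug := fun x ↦ exact_zero.apply_apply_eq_zero x
    let aug' : F 1 →ₗ[A] LinearMap.ker aug := (d 0).codRestrict _ hker
    have haug' : Function.Surjective aug' := by
      rintro ⟨x, hx⟩
      obtain ⟨y, rfl⟩ := (exact_zero x).mp hx
      exact ⟨y, rfl⟩
    have hexact' : Function.Exact (d 1) aug' := by
      intro x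
      rw [← exact_succ 0 x]
      exact ⟨fun h ↦ congrArg Subtype.val h, fun h ↦ Subtype.ext h⟩
    -- Dimension shift: the truncated complex resolves `ker aug`.
    have h' : Subsingleton (Ext (ModuleCat.of A (LinearMap.ker aug)) (ModuleCat.of A N) (i + 1)) := by
      refine subsingleton_of_forall_eq 0 fun y ↦ ?_
      obtain ⟨z, hz⟩ := Ext.contravariant_sequence_exact₁ hS (ModuleCat.of A N) y
        (add_comm 1 (i + 1))
        (Subsingleton.elim (α := Ext (ModuleCat.of A B) (ModuleCat.of A N) (i + 1 + 1)) _ _)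
      rw [← hz]
      have hP : Projective (ModuleCat.of A (F 0)) :=
        (IsProjective.iff_projective (F 0)).mp inferInstance
      rw [Ext.eq_zero_of_projective (P := ModuleCat.of A (F 0)) z]
      exact Ext.comp_zero _ _ _ _ _
    refine ih (fun j ↦ F (j + 1)) (fun j ↦ d (j + 1)) aug' haug' hexact'
      (fun j ↦ exact_succ (j + 1)) h' φ hφ

/-- If `Hom(B, N) = 0`, then the dual into `N` of a presentation of `B` is exact at the first
place. -/
theorem eq_zero_of_comp_eq_zero_of_subsingleton_ext {F₀ F₁ B N : Type u} [AddCommGroup F₀]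
    [Module A F₀] [AddCommGroup F₁] [Module A F₁] [AddCommGroup B] [Module A B] [AddCommGroup N]
    [Module A N] (d : F₁ →ₗ[A] F₀) (aug : F₀ →ₗ[A] B) (haug : Function.Surjective aug)
    (exact_zero : Function.Exact d aug)
    (h : Subsingleton (Ext (ModuleCat.of A B) (ModuleCat.of A N) 0))
    (φ : F₀ →ₗ[A] N) (hφ : φ ∘ₗ d = 0) : φ = 0 := by
  have : Subsingleton (B →ₗ[A] N) :=
    ((Ext.addEquiv₀ (X := ModuleCat.of A B) (Y := ModuleCat.of A N)).trans
      ModuleCat.homAddEquiv).symm.subsingleton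
  have hle : LinearMap.ker aug ≤ LinearMap.ker φ := by
    intro x hx
    obtain ⟨y, rfl⟩ := (exact_zero x).mp hx
    exact LinearMap.congr_fun hφ y
  ext x
  have h1 : ((LinearMap.ker aug).liftQ φ hle) ∘ₗ
      (aug.quotKerEquivOfSurjective haug).symm.toLinearMap = 0 := Subsingleton.elim _ _
  have h2 : (aug.quotKerEquivOfSurjective haug).symm (aug x) = Submodule.Quotient.mk x := by
    rw [LinearEquiv.symm_apply_eq]; rfl
  simpa [h2] using LinearMap.congr_fun h1 (aug x)

end Resolution

/-! ### Consequences of minimality over a local ring -/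

section MinimalResolution

open CategoryTheory Abelian IsLocalRing RingTheory.Sequence

universe u

variable {A : Type u} [CommRing A] [IsLocalRing A]

/-- In a minimal free resolution of `B`, the `i`-th module vanishes if `i > 0` and
`Ext B k i = 0` for the residue field `k`. -/
theorem isEmpty_of_subsingleton_ext_residueField (r : ℕ → ℕ)
    (d : ∀ i, (Fin (r (i + 1)) → A) →ₗ[A] (Fin (r i) → A)) {B : Type u} [AddCommGroup B]
    [Module A B] (aug : (Fin (r 0) → A) →ₗ[A] B) (haug : Function.Surjective aug)
    (exact_zero : Function.Exact (d 0) aug)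
    (exact_succ : ∀ i, Function.Exact (d (i + 1)) (d i))
    (minimal : ∀ i x a, d i x a ∈ maximalIdeal A) (i : ℕ)
    (h : Subsingleton (Ext (ModuleCat.of A B) (ModuleCat.of A (A ⧸ maximalIdeal A)) (i + 1))) :
    IsEmpty (Fin (r (i + 1))) := by
  refine ⟨fun b ↦ ?_⟩
  -- Modulo the maximal ideal the differentials dualize to zero: every functional is a cocycle and
  -- every coboundary vanishes.
  let φ : (Fin (r (i + 1)) → A) →ₗ[A] (A ⧸ maximalIdeal A) :=
    (maximalIdeal A).mkQ ∘ₗ LinearMap.proj b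
  obtain ⟨ψ, hψ⟩ := exists_comp_eq_of_subsingleton_ext i (fun i ↦ Fin (r i) → A) d aug haug
    exact_zero exact_succ h φ (by
      ext x
      simpa [φ, Ideal.Quotient.eq_zero_iff_mem] using! minimal (i + 1) _ b)
  have h1 : φ (Pi.single b 1) = 0 := by
    rw [← hψ, LinearMap.comp_apply, pi_eq_sum_univ (d i (Pi.single b 1)), map_sum]
    refine Finset.sum_eq_zero fun a _ ↦ ?_
    rw [map_smul]
    have hk : ∀ y : A ⧸ maximalIdeal A, ∀ z ∈ maximalIdeal A, z • y = 0 := by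
      intro y z hz
      obtain ⟨y, rfl⟩ := Ideal.Quotient.mk_surjective y
      rw [← Ideal.Quotient.mk_eq_mk, ← Submodule.Quotient.mk_smul, Submodule.Quotient.mk_eq_zero]
      exact Ideal.mul_mem_right _ _ hz
    exact hk _ _ (minimal i _ a)
  simp [φ] at h1

/-- In a minimal free resolution of `B`, no row of the matrix of `Fᵢ₊₁ → Fᵢ` vanishes if
`Ext B A i = 0`. -/
theorem exists_apply_ne_zero_of_subsingleton_ext (r : ℕ → ℕ)
    (d : ∀ i, (Fin (r (i + 1)) → A) →ₗ[A] (Fin (r i) → A)) {B : Type u} [AddCommGroup B]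
    [Module A B] (aug : (Fin (r 0) → A) →ₗ[A] B) (haug : Function.Surjective aug)
    (exact_zero : Function.Exact (d 0) aug)
    (exact_succ : ∀ i, Function.Exact (d (i + 1)) (d i))
    (minimal : ∀ i x a, d i x a ∈ maximalIdeal A) (i : ℕ)
    (h : Subsingleton (Ext (ModuleCat.of A B) (ModuleCat.of A A) i)) (a : Fin (r i)) :
    ∃ b, d i (Pi.single b 1) a ≠ 0 := by
  by_contra! hd
  let φ : (Fin (r i) → A) →ₗ[A] A := LinearMap.proj a
  have hφ : φ ∘ₗ d i = 0 := LinearMap.pi_ext' fun b ↦ by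
    ext
    simpa [φ] using hd b
  have hφ1 : φ (Pi.single a 1) = 1 := by simp [φ]
  cases i with
  | zero =>
    rw [eq_zero_of_comp_eq_zero_of_subsingleton_ext (d 0) aug haug exact_zero h φ hφ] at hφ1
    simp at hφ1
  | succ i =>
    obtain ⟨ψ, hψ⟩ := exists_comp_eq_of_subsingleton_ext i (fun i ↦ Fin (r i) → A) d aug haug
      exact_zero exact_succ h φ hφ
    have h1 : φ (Pi.single a 1) ∈ maximalIdeal A := by
      rw [← hψ, LinearMap.comp_apply, pi_eq_sum_univ (d i (Pi.single a 1)), map_sum]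
      refine Ideal.sum_mem _ fun b _ ↦ ?_
      rw [map_smul]
      exact Ideal.mul_mem_right _ _ (minimal i _ b)
    rw [hφ1] at h1
    exact (Ideal.ne_top_iff_one _).mp (maximalIdeal.isMaximal A).ne_top h1

end MinimalResolution

/-! ### Regular sequences, grade and height -/

section Height

open CategoryTheory Abelian IsLocalRing RingTheory.Sequence

universe u

/-- After localizing at `P` the sequence is regular, so dividing by it lowers the dimension, which
is the height of `P`, by its length, and the quotient is nonzero. -/
theorem RingTheory.Sequence.IsWeaklyRegular.length_le_height {A : Type u} [CommRing A]
    [IsNoetherianRing A] {rs : List A} (reg : IsWeaklyRegular A rs) (P : Ideal A) [P.IsPrime]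
    (hP : ∀ r ∈ rs, r ∈ P) : (rs.length : ℕ∞) ≤ P.height := by
  have h1 := reg.isRegular_of_isLocalization_of_mem (S := Localization.AtPrime P) P hP
  have h2 := ringKrullDim_add_length_eq_ringKrullDim_of_isRegular _ h1
  rw [IsLocalization.AtPrime.ringKrullDim_eq_height P (Localization.AtPrime P), List.length_map] at h2
  have h3 : Nontrivial (Localization.AtPrime P ⧸
      Ideal.ofList (rs.map (algebraMap A (Localization.AtPrime P)))) := by
    rw [Ideal.Quotient.nontrivial_iff]
    intro h
    exact h1.top_ne_smul (by rw [h]; simp)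
  have h4 := ringKrullDim_nonneg_of_nontrivial (R := Localization.AtPrime P ⧸
      Ideal.ofList (rs.map (algebraMap A (Localization.AtPrime P))))
  have h5 : ((rs.length : ℕ∞) : WithBot ℕ∞) ≤ P.height := by
    rw [← h2]
    exact le_add_of_nonneg_left h4
  exact WithBot.coe_le_coe.mp h5

/-- The easy inequality between grade and height. -/
theorem le_height_of_subsingleton_ext {A : Type u} [CommRing A] [IsNoetherianRing A]
    [IsLocalRing A] {B : Type u} [AddCommGroup B] [Module A B] [Module.Finite A B] [Nontrivial B]
    (g : ℕ) (h : ∀ i < g, Subsingleton (Ext (ModuleCat.of A B) (ModuleCat.of A A) i))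
    (P : Ideal A) [P.IsPrime] (hP : Module.annihilator A B ≤ P) : (g : ℕ∞) ≤ P.height := by
  obtain ⟨rs, rfl, hrs, reg⟩ := ModuleCat.exists_isRegular_of_exists_subsingleton_ext
    (Module.annihilator A B) g (ModuleCat.of A A) (by
      rw [lt_top_iff_ne_top]
      intro h
      have h1 : Module.annihilator A B = ⊤ := by
        rw [← h]
        exact (Ideal.mul_top _).symm
      exact ‹P.IsPrime›.ne_top (top_le_iff.mp (h1 ▸ hP)))
    (ModuleCat.of A B) Module.support_eq_zeroLocus h
  exact reg.toIsWeaklyRegular.length_le_height P fun r hr ↦ hP (hrs r hr)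

/-- `ht I + dim R / I ≤ dim R`. -/
theorem Ideal.height_add_le_ringKrullDim {R : Type*} [CommRing R] {I : Ideal R} {d : ℕ}
    (hd : (d : WithBot ℕ∞) ≤ ringKrullDim (R ⧸ I)) :
    ((I.height + d : ℕ∞) : WithBot ℕ∞) ≤ ringKrullDim R := by
  rw [ringKrullDim_quotient, Order.le_krullDim_iff] at hd
  obtain ⟨l, rfl⟩ := hd
  -- Along a chain of primes containing `I`, heights start at `I.height` or above and grow by at
  -- least one per step.
  have key : ∀ i : ℕ, ∀ hi : i < l.length + 1,
      I.height + i ≤ (l ⟨i, hi⟩).1.asIdeal.height := by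
    intro i
    induction i with
    | zero =>
      intro hi
      simpa using! Ideal.height_mono (l ⟨0, hi⟩).2
    | succ i ih =>
      intro hi
      have h1 : (l ⟨i, by omega⟩).1.asIdeal < (l ⟨i + 1, hi⟩).1.asIdeal :=
        l.strictMono (Fin.mk_lt_mk.mpr (Nat.lt_succ_self i))
      have := Ideal.height_add_one_le_of_lt_of_isPrime h1
      push_cast
      rw [← add_assoc]
      exact (add_le_add_left (ih _) 1).trans this
  exact (WithBot.coe_le_coe.mpr (key l.length (Nat.lt_succ_self _))).trans
    Ideal.height_le_ringKrullDim_of_isPrime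

end Height

/-! ### The variables and homogeneous ideals -/

section PolynomialRing

open RingTheory.Sequence

namespace MvPolynomial

theorem isWeaklyRegular_ofFn_X (k : Type*) [Field k] (n : ℕ) :
    IsWeaklyRegular (MvPolynomial (Fin n) k) (List.ofFn (X : Fin n → MvPolynomial (Fin n) k)) := by
  refine ⟨fun i hi ↦ ?_⟩
  have hin : i < n := by simpa using hi
  have hspan : Ideal.ofList ((List.ofFn (X : Fin n → MvPolynomial (Fin n) k)).take i) =
      Ideal.span (X '' {j : Fin n | j.1 < i}) := by
    rw [Ideal.ofList]
    congr 1
    ext p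
    simp only [Set.mem_ofPred_eq, Set.mem_image, List.mem_take_iff_getElem, List.getElem_ofFn,
      List.length_ofFn]
    constructor
    · rintro ⟨j, hj, rfl⟩
      exact ⟨⟨j, by omega⟩, by simp; omega, rfl⟩
    · rintro ⟨j, hj, rfl⟩
      exact ⟨j, by have := j.2; omega, rfl⟩
  have htop : (Ideal.ofList ((List.ofFn (X : Fin n → MvPolynomial (Fin n) k)).take i) • ⊤ :
      Submodule (MvPolynomial (Fin n) k) (MvPolynomial (Fin n) k)) =
      Ideal.span (X '' {j : Fin n | j.1 < i}) := by
    rw [hspan]; exact Ideal.mul_top _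
  rw [htop, isSMulRegular_quotient_iff_mem_of_smul_mem]
  intro p hp
  rw [List.getElem_ofFn, smul_eq_mul, mul_comm, mem_ideal_span_X_image] at hp
  rw [mem_ideal_span_X_image]
  intro s hs
  -- Membership in an ideal of variables is tested on monomials, and multiplying by the `i`-th
  -- variable does not affect the exponents of the earlier ones.
  obtain ⟨j, hj, hsj⟩ := hp (s + Finsupp.single ⟨i, hin⟩ 1) (by
    rw [mem_support_iff, coeff_mul_X]; exact mem_support_iff.mp hs)
  refine ⟨j, hj, ?_⟩
  have hne : (⟨i, hin⟩ : Fin n) ≠ j := by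
    rintro rfl
    exact lt_irrefl i hj
  simpa [Finsupp.single_apply, hne] using hsj

theorem ofList_ofFn_X (k : Type*) [Field k] (n : ℕ) :
    Ideal.ofList (List.ofFn (X : Fin n → MvPolynomial (Fin n) k)) = idealOfVars (Fin n) k := by
  rw [Ideal.ofList, idealOfVars]
  congr 1
  ext p
  simp [List.mem_ofFn]

theorem mem_idealOfVars_iff_coeff_zero {k : Type*} [Field k] {n : ℕ} {p : MvPolynomial (Fin n) k} :
    p ∈ idealOfVars (Fin n) k ↔ coeff 0 p = 0 := by
  rw [idealOfVars, ← Set.image_univ, mem_ideal_span_X_image]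
  constructor
  · intro h
    by_contra h0
    obtain ⟨i, -, hi⟩ := h 0 (mem_support_iff.mpr h0)
    exact hi rfl
  · intro h s hs
    have : s ≠ 0 := by
      rintro rfl
      exact mem_support_iff.mp hs h
    obtain ⟨i, hi⟩ := Finsupp.ne_iff.mp this
    exact ⟨i, trivial, hi⟩

instance isMaximal_idealOfVars (k : Type*) [Field k] (n : ℕ) :
    (idealOfVars (Fin n) k).IsMaximal := by
  have : idealOfVars (Fin n) k = RingHom.ker (constantCoeff (R := k) (σ := Fin n)) := by
    ext p
    rw [mem_idealOfVars_iff_coeff_zero, RingHom.mem_ker, constantCoeff_eq]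
  rw [this]
  exact RingHom.ker_isMaximal_of_surjective _ fun x ↦ ⟨C x, constantCoeff_C _ x⟩

theorem le_idealOfVars_of_isHomogeneous {k : Type*} [Field k] {n : ℕ}
    {I : Ideal (MvPolynomial (Fin n) k)} (hI : I.IsHomogeneous (homogeneousSubmodule (Fin n) k))
    (htop : I ≠ ⊤) : I ≤ idealOfVars (Fin n) k := by
  intro p hp
  rw [mem_idealOfVars_iff_coeff_zero]
  by_contra h
  have h1 := hI 0 hp
  rw [show ((DirectSum.decompose (homogeneousSubmodule (Fin n) k) p 0 :
    homogeneousSubmodule (Fin n) k 0) : MvPolynomial (Fin n) k) = homogeneousComponent 0 p from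
    decomposition.decompose'_apply p 0, homogeneousComponent_zero] at h1
  exact htop (Ideal.eq_top_of_isUnit_mem _ h1 ((isUnit_iff_ne_zero.mpr h).map C))

/-- A prime over `I` of height `c` may lie outside the origin's local ring; its homogeneous core is
still prime, contains `I`, and is no higher. Thus the codimension is visible after localizing at the
origin. -/
theorem exists_isPrime_le_idealOfVars {k : Type*} [Field k] {n c : ℕ}
    {I : Ideal (MvPolynomial (Fin n) k)} (hI : I.IsHomogeneous (homogeneousSubmodule (Fin n) k))
    (hc : I.height = (c : ℕ∞)) :
    ∃ P : Ideal (MvPolynomial (Fin n) k), P.IsPrime ∧ I ≤ P ∧ P ≤ idealOfVars (Fin n) k ∧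
      P.height ≤ c := by
  obtain ⟨P, hP, hIP, hPc⟩ := Ideal.exists_isPrime_height_eq hc
  have hQ := hP.homogeneousCore (𝒜 := homogeneousSubmodule (Fin n) k)
  refine ⟨(P.homogeneousCore (homogeneousSubmodule (Fin n) k)).toIdeal, hQ, ?_, ?_, ?_⟩
  · rw [← hI.toIdeal_homogeneousCore_eq_self]
    exact Ideal.homogeneousCore_mono _ hIP
  · exact le_idealOfVars_of_isHomogeneous (HomogeneousIdeal.isHomogeneous _) hQ.ne_top
  · rw [← hPc]
    exact Ideal.height_mono (Ideal.toIdeal_homogeneousCore_le _ _)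

end MvPolynomial

end PolynomialRing

/-! ### Parameters from the Cohen–Macaulay condition -/

section CohenMacaulay

open IsLocalRing RingTheory.Sequence

/-- A Cohen–Macaulay local ring has a regular sequence in its maximal ideal whose length is the
Krull dimension. -/
theorem IsCohenMacaulayLocalRing.exists_isRegular {B : Type*} [CommRing B] [IsLocalRing B]
    (h : IsCohenMacaulayLocalRing B) :
    ∃ rs : List B, (∀ r ∈ rs, r ∈ maximalIdeal B) ∧ IsRegular B rs ∧
      ringKrullDim B = rs.length := by
  obtain ⟨hN, hd⟩ := h
  obtain ⟨d, hdim⟩ : ∃ d : ℕ, ringKrullDim B = d :=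
    ⟨_, (maximalIdeal_height_eq_ringKrullDim (R := B)).symm.trans
      (congrArg _ (ENat.natCast_toNat (Ideal.height_ne_top (Ideal.IsPrime.ne_top inferInstance))).symm)⟩
  have hdepth : localDepth B = d := WithBot.coe_injective (hd.trans hdim)
  -- The supremum defining a finite depth is attained; the empty sequence covers depth 0.
  have hex : ∃ rs : List B, (∀ r ∈ rs, r ∈ maximalIdeal B) ∧ IsRegular B rs ∧ d ≤ rs.length := by
    by_contra! hlt
    cases d with
    | zero => exact (hlt [] (by simp) (IsRegular.nil B B)).not_ge (Nat.zero_le _)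
    | succ d =>
      have h1 : localDepth B ≤ d := iSup_le fun rs ↦ iSup_le fun h1 ↦ iSup_le fun h2 ↦
        Nat.cast_le.mpr (Nat.lt_succ_iff.mp (hlt rs h1 h2))
      rw [hdepth] at h1
      exact absurd (Nat.cast_le.mp h1) (by omega)
  obtain ⟨rs, h1, h2, h3⟩ := hex
  refine ⟨rs, h1, h2, le_antisymm (hdim.trans_le (by exact_mod_cast h3)) ?_⟩
  have h4 := ringKrullDim_add_length_eq_ringKrullDim_of_isRegular rs h2
  have : Nontrivial (B ⧸ Ideal.ofList rs) := by
    rw [Ideal.Quotient.nontrivial_iff]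
    intro h
    exact h2.top_ne_smul (by rw [h]; simp)
  rw [← h4]
  exact le_add_of_nonneg_left ringKrullDim_nonneg_of_nontrivial

theorem isArtinianRing_quotient_of_isRegular {B : Type*} [CommRing B] [IsLocalRing B]
    [IsNoetherianRing B] {rs : List B} (h : IsRegular B rs) (hd : ringKrullDim B = rs.length) :
    IsArtinianRing (B ⧸ Ideal.ofList rs) := by
  rw [isArtinianRing_iff_krullDimLE_zero, Ring.krullDimLE_iff]
  have h4 := ringKrullDim_add_length_eq_ringKrullDim_of_isRegular rs h
  rw [hd] at h4
  have h5 : ringKrullDim (B ⧸ Ideal.ofList rs) + (rs.length : WithBot ℕ∞) ≤ 0 + rs.length := by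
    rw [h4, zero_add]
  simpa using (ENat.WithBot.add_le_add_natCast_right_iff).mp h5

/-- Lifting a maximal regular sequence of `B` to `A` makes it usable for Ext over `A`; finite length
holds because the quotient of `B` is Artinian and `A` surjects onto it. -/
theorem IsCohenMacaulayLocalRing.exists_isWeaklyRegular {A B : Type*} [CommRing A] [IsLocalRing A]
    [IsNoetherianRing A] [CommRing B] [IsLocalRing B] [Algebra A B]
    (hsurj : Function.Surjective (algebraMap A B)) (h : IsCohenMacaulayLocalRing B) :
    ∃ fs : List A, (∀ f ∈ fs, f ∈ maximalIdeal A) ∧ IsWeaklyRegular B fs ∧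
      IsFiniteLength A (B ⧸ (Ideal.ofList fs • ⊤ : Submodule A B)) ∧
      ringKrullDim B = fs.length := by
  obtain ⟨rs, hrs, hreg, hd⟩ := h.exists_isRegular
  have := h.1
  obtain ⟨fs, rfl⟩ := List.map_surjective_iff.mpr hsurj rs
  refine ⟨fs, fun f hf ↦ ?_, (isWeaklyRegular_map_algebraMap_iff B B fs).mp hreg.1, ?_,
    by simpa using hd⟩
  · have h1 := hrs _ (List.mem_map_of_mem hf)
    rw [mem_maximalIdeal, mem_nonunits_iff] at h1 ⊢
    exact fun h2 ↦ h1 (h2.map _)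
  · have h1 := isArtinianRing_quotient_of_isRegular hreg hd
    rw [← Ideal.map_ofList] at h1
    rw [Ideal.smul_top_eq_map]
    refine (Submodule.Quotient.restrictScalarsEquiv A _).symm.isFiniteLength ?_
    have hs : Function.Surjective
        (algebraMap A (B ⧸ (Ideal.ofList fs).map (algebraMap A B))) :=
      Ideal.Quotient.mk_surjective.comp hsurj
    rw [isFiniteLength_iff_isNoetherian_isArtinian]
    refine ⟨isNoetherian_of_surjective (Algebra.linearMap A _) (LinearMap.range_eq_top.mpr hs),
      isArtinian_of_surjective_algebraMap hs⟩

end CohenMacaulay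

/-! ### Localizing the resolution -/

section Localization

open IsLocalRing

/-- Localizing a free resolution. -/
theorem exists_localized_resolution {R A M B : Type*} [CommRing R] (S : Submonoid R) [CommRing A]
    [Algebra R A] [IsLocalization S A] [AddCommGroup M] [Module R M] [AddCommGroup B] [Module R B]
    [Module A B] [IsScalarTower R A B] (f : M →ₗ[R] B) [IsLocalizedModule S f] (r : ℕ → ℕ)
    (d : ∀ i, (Fin (r (i + 1)) → R) →ₗ[R] (Fin (r i) → R)) (aug : (Fin (r 0) → R) →ₗ[R] M)
    (haug : Function.Surjective aug) (exact_zero : Function.Exact (d 0) aug)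
    (exact_succ : ∀ i, Function.Exact (d (i + 1)) (d i)) :
    ∃ (D : ∀ i, (Fin (r (i + 1)) → A) →ₗ[A] (Fin (r i) → A)) (aug' : (Fin (r 0) → A) →ₗ[A] B),
      Function.Surjective aug' ∧ Function.Exact (D 0) aug' ∧
      (∀ i, Function.Exact (D (i + 1)) (D i)) ∧
      ∀ i b a, D i (Pi.single b 1) a = algebraMap R A (d i (Pi.single b 1) a) := by
  let g (i : ℕ) : (Fin (r i) → R) →ₗ[R] (Fin (r i) → A) :=
    LinearMap.pi fun j ↦ Algebra.linearMap R A ∘ₗ LinearMap.proj j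
  have hg (i : ℕ) : IsLocalizedModule S (g i) := IsLocalizedModule.pi S _
  refine ⟨fun i ↦ IsLocalizedModule.mapExtendScalars S (g (i + 1)) (g i) A (d i),
    IsLocalizedModule.mapExtendScalars S (g 0) f A aug, ?_, ?_, fun i ↦ ?_, fun i b a ↦ ?_⟩
  · exact IsLocalizedModule.map_surjective S (g 0) f aug haug
  · exact IsLocalizedModule.map_exact S (g 1) (g 0) f (d 0) aug exact_zero
  · exact IsLocalizedModule.map_exact S (g (i + 2)) (g (i + 1)) (g i) _ _ (exact_succ i)
  · have h1 : (Pi.single b 1 : Fin (r (i + 1)) → A) = g (i + 1) (Pi.single b 1) := by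
      ext j
      by_cases hj : j = b
      · subst hj; simp [g]
      · simp [g, hj]
    rw [h1, IsLocalizedModule.mapExtendScalars_apply_apply, IsLocalizedModule.map_apply]
    rfl

theorem apply_mem_of_forall_single_mem {A : Type*} [CommRing A] {m : Ideal A} {p q : ℕ}
    (D : (Fin p → A) →ₗ[A] (Fin q → A)) (h : ∀ b a, D (Pi.single b 1) a ∈ m) (x : Fin p → A)
    (a : Fin q) : D x a ∈ m := by
  rw [← Finset.univ_sum_single x, map_sum, Finset.sum_apply]
  refine Ideal.sum_mem _ fun b _ ↦ ?_
  have h1 : (Pi.single b (x b) : Fin p → A) = x b • Pi.single b 1 := by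
    rw [← Pi.single_smul, smul_eq_mul, mul_one]
  rw [h1, map_smul, Pi.smul_apply, smul_eq_mul]
  exact Ideal.mul_mem_left _ _ (h b a)

theorem apply_mem_of_mem_smul_top {A : Type*} [CommRing A] {m : Ideal A} {q : ℕ} {x : Fin q → A}
    (hx : x ∈ m • (⊤ : Submodule A (Fin q → A))) (a : Fin q) : x a ∈ m := by
  induction hx using Submodule.smul_induction_on' with
  | smul r hr x _ => exact Ideal.mul_mem_right _ _ hr
  | add x _ y _ hx hy => exact Ideal.add_mem _ hx hy

end Localization

/-! ### Length and nonzero rows of the resolution -/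

section Main

open CategoryTheory Abelian IsLocalRing RingTheory.Sequence MvPolynomial

namespace MinimalGradedFreeResolution

/-- The minimal resolution of a Cohen–Macaulay quotient has length at most the codimension `c`, and
the matrices of the first `c` differentials have no zero row. -/
theorem isEmpty_and_exists_apply_ne_zero {k : Type*} [Field k] {n c : ℕ}
    {I : Ideal (MvPolynomial (Fin n) k)}
    (hI : I.IsHomogeneous (MvPolynomial.homogeneousSubmodule (Fin n) k))
    (hc : I.height = (c : ℕ∞))
    (hCM : IsCohenMacaulayRing (MvPolynomial (Fin n) k ⧸ I))
    (F : MinimalGradedFreeResolution I) :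
    (∀ i, c < i → IsEmpty (Fin (F.rank i))) ∧
      ∀ i < c, ∀ a, ∃ b, F.d i (Pi.single b 1) a ≠ 0 := by
  obtain ⟨P, hP, hIP, hPm, hPc⟩ := exists_isPrime_le_idealOfVars hI hc
  set m := idealOfVars (Fin n) k with hm
  have hIm : I ≤ m := hIP.trans hPm
  have hker : RingHom.ker (Ideal.Quotient.mk I) ≤ m := by rwa [Ideal.mk_ker]
  let p : Ideal (MvPolynomial (Fin n) k ⧸ I) := m.map (Ideal.Quotient.mk I)
  have hcomap : p.comap (Ideal.Quotient.mk I) = m := by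
    rw [Ideal.comap_map_of_surjective _ Ideal.Quotient.mk_surjective, ← RingHom.ker_eq_comap_bot,
      sup_eq_left.mpr hker]
  have hp : p.IsMaximal := Ideal.IsMaximal.map_of_surjective_of_ker_le
    Ideal.Quotient.mk_surjective hker
  let A := Localization.AtPrime m
  let B := Localization.AtPrime p
  let φ : A →+* B := Localization.localRingHom m p (Ideal.Quotient.mk I) hcomap.symm
  have hφ : Function.Surjective φ := by
    intro y
    obtain ⟨r, ⟨s, hs⟩, rfl⟩ := IsLocalization.exists_mk'_eq p.primeCompl y
    obtain ⟨r, rfl⟩ := Ideal.Quotient.mk_surjective r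
    obtain ⟨s, rfl⟩ := Ideal.Quotient.mk_surjective s
    refine ⟨IsLocalization.mk' A r (⟨s, fun h ↦ hs (Ideal.mem_map_of_mem _ h)⟩ : m.primeCompl), ?_⟩
    exact Localization.localRingHom_mk' ..
  let : Algebra A B := φ.toAlgebra
  have : IsScalarTower (MvPolynomial (Fin n) k) A B := IsScalarTower.of_algebraMap_eq fun x ↦ by
    exact (Localization.localRingHom_to_map m p (Ideal.Quotient.mk I) hcomap.symm x).symm
  have : IsLocalization (Algebra.algebraMapSubmonoid (MvPolynomial (Fin n) k ⧸ I) m.primeCompl)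
      B := by
    have : Algebra.algebraMapSubmonoid (MvPolynomial (Fin n) k ⧸ I) m.primeCompl =
        p.primeCompl := by
      ext y
      constructor
      · rintro ⟨x, hx, rfl⟩ hxp
        exact hx (hcomap ▸ hxp)
      · intro hy
        obtain ⟨x, rfl⟩ := Ideal.Quotient.mk_surjective y
        exact ⟨x, fun h ↦ hy (Ideal.mem_map_of_mem _ h), rfl⟩
    rw [this]
    infer_instance
  have : Module.Finite A B := Module.Finite.of_surjective (Algebra.linearMap A B) hφ
  have hxs : IsRegular A ((List.ofFn (X : Fin n → MvPolynomial (Fin n) k)).map (algebraMap _ A)) :=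
    (isWeaklyRegular_ofFn_X k n).isRegular_of_isLocalization_of_mem (S := A) m fun r hr ↦ by
      rw [hm, ← ofList_ofFn_X]
      exact Ideal.subset_span hr
  have hxm : Ideal.ofList ((List.ofFn (X : Fin n → MvPolynomial (Fin n) k)).map
      (algebraMap _ A)) = maximalIdeal A := by
    rw [← Ideal.map_ofList, ofList_ofFn_X]
    exact Localization.AtPrime.map_eq_maximalIdeal
  obtain ⟨fs, hfs, hreg, hlen, hdim⟩ :=
    IsCohenMacaulayLocalRing.exists_isWeaklyRegular (A := A) hφ (hCM.2 p)
  -- Together with `hge` this gives `c = n - |fs|`; here, height plus dimension of the quotient is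
  -- at most `n`.
  have hle : c + fs.length ≤ n := by
    have h1 : ((fs.length : ℕ) : WithBot ℕ∞) ≤ ringKrullDim (MvPolynomial (Fin n) k ⧸ I) := by
      rw [← hdim, IsLocalization.AtPrime.ringKrullDim_eq_height p B]
      exact Ideal.height_le_ringKrullDim_of_isPrime
    have h2 := Ideal.height_add_le_ringKrullDim h1
    rw [hc, MvPolynomial.ringKrullDim_of_isNoetherianRing] at h2
    simp at h2
    exact_mod_cast h2
  have hext (i : ℕ) (hi : i + fs.length < n) :
      Subsingleton (Ext (ModuleCat.of A B) (ModuleCat.of A A) i) :=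
    subsingleton_ext_self_of_isWeaklyRegular hxs hxm fs hfs B hreg hlen i (by simpa using hi)
  have hge : n ≤ c + fs.length := by
    -- The extension of `P` to `A` has the height of `P`, at most `c`, and contains the annihilator
    -- of `B`, so it bounds the grade `n - |fs|` from above.
    have hPA : (P.map (algebraMap _ A)).IsPrime := Ideal.isPrime_map_of_isLocalizationAtPrime m hPm
    have h1 := le_height_of_subsingleton_ext (A := A) (B := B) (n - fs.length)
      (fun i hi ↦ hext i (by omega)) (P.map (algebraMap _ A)) (by
        intro a ha
        have h1 : φ a = 0 := by
          have := Module.mem_annihilator.mp ha (1 : B)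
          rwa [Algebra.smul_def, mul_one] at this
        obtain ⟨r, s, rfl⟩ := IsLocalization.exists_mk'_eq m.primeCompl a
        rw [Localization.localRingHom_mk', IsLocalization.mk'_eq_zero_iff] at h1
        obtain ⟨⟨t, ht⟩, h1⟩ := h1
        obtain ⟨t, rfl⟩ := Ideal.Quotient.mk_surjective t
        rw [← map_mul, Ideal.Quotient.eq_zero_iff_mem] at h1
        rw [IsLocalization.mk'_mem_iff]
        refine Ideal.mem_map_of_mem _ ((hP.mem_or_mem (hIP h1)).resolve_left fun h2 ↦ ht ?_)
        exact Ideal.mem_map_of_mem _ (hPm h2))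
    rw [← IsLocalization.height_under m.primeCompl, Ideal.under_map_of_isLocalizationAtPrime m hPm]
      at h1
    have h2 := h1.trans hPc
    norm_cast at h2
    omega
  obtain ⟨D, aug', haug', hD0, hD, hDd⟩ := exists_localized_resolution (A := A) (B := B) m.primeCompl
    (IsScalarTower.toAlgHom (MvPolynomial (Fin n) k) (MvPolynomial (Fin n) k ⧸ I) B).toLinearMap
    F.rank F.d F.aug F.aug_surjective F.exact_zero F.exact_succ
  have hmin (i x a) : D i x a ∈ maximalIdeal A := by
    refine apply_mem_of_forall_single_mem (D i) (fun b a ↦ ?_) x a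
    rw [hDd, ← Localization.AtPrime.map_eq_maximalIdeal]
    exact Ideal.mem_map_of_mem _ (apply_mem_of_mem_smul_top (F.minimal i ⟨_, rfl⟩) a)
  refine ⟨fun i hi ↦ ?_, fun i hi a ↦ ?_⟩
  · obtain ⟨i, rfl⟩ : ∃ j, i = j + 1 := ⟨i - 1, by omega⟩
    exact isEmpty_of_subsingleton_ext_residueField F.rank D aug' haug' hD0 hD hmin i
      (subsingleton_ext_of_isWeaklyRegular hxs hxm fs hfs B hreg hlen _ _ (by simp; omega))
  · obtain ⟨b, hb⟩ := exists_apply_ne_zero_of_subsingleton_ext F.rank D aug' haug' hD0 hD hmin i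
      (hext i (by omega)) a
    refine ⟨b, fun h ↦ hb ?_⟩
    rw [hDd, h, map_zero]

end MinimalGradedFreeResolution

end Main

/-! ### Degrees of the entries and Betti numbers -/

section BettiNumbers

open MvPolynomial

theorem IsHomogeneousOfDegree.one_le {k : Type*} [Field k] {n : ℕ} {p : MvPolynomial (Fin n) k}
    {e : ℤ} (hp : IsHomogeneousOfDegree p e) (h0 : p ≠ 0) (hm : p ∈ idealOfVars (Fin n) k) :
    1 ≤ e := by
  obtain ⟨s, hs⟩ := support_nonempty.mpr h0
  rw [← hp s hs]
  have hs0 : s ≠ 0 := by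
    rintro rfl
    exact mem_support_iff.mp hs (mem_idealOfVars_iff_coeff_zero.mp hm)
  have : s.degree ≠ 0 := fun h ↦ hs0 ((Finsupp.degree_eq_zero_iff s).mp h)
  omega

namespace MinimalGradedFreeResolution

variable {k : Type*} [Field k] {n : ℕ} {I : Ideal (MvPolynomial (Fin n) k)}
  (F : MinimalGradedFreeResolution I)

theorem betti_ne_zero_iff {i : ℕ} {j : ℤ} : F.betti i j ≠ 0 ↔ ∃ a, F.shift i a = j := by
  rw [betti, ← Nat.pos_iff_ne_zero, Fintype.card_pos_iff]
  exact nonempty_subtype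

theorem exists_betti_ne_zero_iff {i : ℕ} :
    (∃ j : ℤ, F.betti i j ≠ 0) ↔ Nonempty (Fin (F.rank i)) := by
  simp only [betti_ne_zero_iff]
  exact ⟨fun ⟨_, a, _⟩ ↦ ⟨a⟩, fun ⟨a⟩ ↦ ⟨_, a, rfl⟩⟩

theorem shift_add_one_le {i : ℕ} {a : Fin (F.rank i)} {b : Fin (F.rank (i + 1))}
    (h : F.d i (Pi.single b 1) a ≠ 0) : F.shift i a + 1 ≤ F.shift (i + 1) b := by
  have := (F.d_homogeneous i b a).one_le h (apply_mem_of_mem_smul_top (F.minimal i ⟨_, rfl⟩) a)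
  omega

theorem nonempty_rank_zero (hI : I ≠ ⊤) : Nonempty (Fin (F.rank 0)) := by
  by_contra h
  rw [not_nonempty_iff] at h
  have : Nontrivial (MvPolynomial (Fin n) k ⧸ I) := Ideal.Quotient.nontrivial_iff.mpr hI
  have : Subsingleton (MvPolynomial (Fin n) k ⧸ I) := F.aug_surjective.subsingleton
  exact not_subsingleton _ this

theorem exists_isGreatest {i : ℕ} (h : Nonempty (Fin (F.rank i))) :
    ∃ M, IsGreatest {j : ℤ | F.betti i j ≠ 0} M := by
  obtain ⟨a, ha⟩ := Finite.exists_max (F.shift i)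
  refine ⟨F.shift i a, F.betti_ne_zero_iff.mpr ⟨a, rfl⟩, fun j hj ↦ ?_⟩
  obtain ⟨b, rfl⟩ := F.betti_ne_zero_iff.mp hj
  exact ha b

end MinimalGradedFreeResolution

end BettiNumbers

theorem mainTheorem8 {k : Type*} [Field k] (n c : ℕ) (I : Ideal (MvPolynomial (Fin n) k))
    (hI : I.IsHomogeneous (MvPolynomial.homogeneousSubmodule (Fin n) k))
    (hc : I.height = (c : ℕ∞))
    (hCM : IsCohenMacaulayRing (MvPolynomial (Fin n) k ⧸ I))
    (F : MinimalGradedFreeResolution I) :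
    (∀ i : ℕ, (∃ j : ℤ, F.betti i j ≠ 0) ↔ i ≤ c) ∧
      ∃ M : ℕ → ℤ,
        (∀ i : ℕ, i ≤ c → IsGreatest {j : ℤ | F.betti i j ≠ 0} (M i)) ∧
        ∀ i : ℕ, 1 ≤ i → i ≤ c → M i ≥ M (i - 1) + 1 := by
  obtain ⟨hempty, hrow⟩ := F.isEmpty_and_exists_apply_ne_zero hI hc hCM
  have htop : I ≠ ⊤ := by
    rintro rfl
    simp [Ideal.height_top] at hc
  have hne : ∀ i ≤ c, Nonempty (Fin (F.rank i)) := by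
    intro i
    induction i with
    | zero => exact fun _ ↦ F.nonempty_rank_zero htop
    | succ i ih =>
      intro hi
      obtain ⟨a⟩ := ih (by omega)
      -- A nonzero row needs a column, so `Fᵢ₊₁` is nonzero.
      obtain ⟨b, -⟩ := hrow i (by omega) a
      exact ⟨b⟩
  refine ⟨fun i ↦ ?_, ?_⟩
  · rw [F.exists_betti_ne_zero_iff]
    refine ⟨fun h ↦ ?_, hne i⟩
    by_contra! hi
    exact not_isEmpty_iff.mpr h (hempty i hi)
  -- The value of `M` beyond `c` is irrelevant and set to 0.
  have hM : ∀ i, ∃ M, i ≤ c → IsGreatest {j : ℤ | F.betti i j ≠ 0} M := by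
    intro i
    by_cases hi : i ≤ c
    · obtain ⟨M, hM⟩ := F.exists_isGreatest (hne i hi)
      exact ⟨M, fun _ ↦ hM⟩
    · exact ⟨0, fun h ↦ absurd h hi⟩
  choose M hM using hM
  refine ⟨M, hM, fun i h1 hi ↦ ?_⟩
  obtain ⟨i, rfl⟩ : ∃ j, i = j + 1 := ⟨i - 1, by omega⟩
  rw [Nat.add_sub_cancel]
  -- `a` attains the maximal shift, and a nonzero entry in its row gives `b` of larger degree.
  obtain ⟨a, ha⟩ := F.betti_ne_zero_iff.mp (hM i (by omega)).1
  obtain ⟨b, hb⟩ := hrow i (by omega) a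
  have h2 := F.shift_add_one_le hb
  have h3 := (hM (i + 1) hi).2 (F.betti_ne_zero_iff.mpr ⟨b, rfl⟩)
  rw [ha] at h2
  exact h2.trans h3
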